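/- Let $\Theta$ (states) and $A$ (actions) be finite sets, $u(a)\in\mathbb{R}^{\Theta}$ the task payoff vector of $a\in A$ (a row vector), and $X(a)\in\mathbb{R}^{m\times\Theta}$, $a\in A$, a profile of $m$ questions. A belief is a probability vector $p$ on $\Theta$, and $a$ is optimal under $p$ if it maximizes $\mathbb{E}_p u(a)=\sum_\theta p(\theta)u(a;\theta)$ over $A$. Assume that there are no redundant actions: every action that is optimal under some belief is the unique optimal action under some belief. $X$ is *incentivizable* if there is $V:\mathbb{R}^m\times A\times\Theta\to[0,1]$ such that for every belief $p$ $$\arg\max_{(r,a)\in\mathbb{R}^m\times A}\mathbb{E}_p[V(r,a,\theta)]=\Big\{(\mathbb{E}_pX(a),a): a\in\arg\max_{a'\in A}\mathbb{E}_p u(a')\Big\}.$$ $X$ is *robustly incentivizable* if there are invertible $\mu(a)\in\mathbb{R}^{m\times m}$, $a\in A$, such that for every $t\in\mathbb{R}^{m\times\Theta}$ the profile $X(a)+\mu(a)t$ is incentivizable. The *adjacency graph* $G$ has vertex set $A$; distinct $a,b$ are joined by an edge if under some belief the set of optimal actions is exactly $\{a,b\}$. A *block* of $G$ is a maximal connected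 subgraph without cut-vertices. A *minimum cycle basis* of $G$ is a set of cycles of minimum total length whose (signed) incidence vectors form a basis of the kernel of the oriented vertex-edge incidence matrix of $G$ over $\mathbb{R}$. For $v\in\mathbb{R}^\Theta$ let $\bar v=v-\frac1{|\Theta|}\sum_{\theta}v(\theta)\mathbf{1}$, and let $\Delta_a^b=\bar u(b)-\bar u(a)$. *Independence assumption:* $G$ has a minimum cycle basis such that, for each of its cycles $C$, the family $\{\Delta_a^b:(a\to b)\in C\}$ has rank $|C|-1$. **Proposition.** Under these assumptions, $X$ is robustly incentivizable if and only if it is *blockwise jointly aligned* with $u$, that is, there are $\lambda_z\in\mathbb{R}^m$ (a column vector) and $d_z\in\mathbb{R}^{m\times\Theta}$ for each block $B_z$ of $G$, and an invertible $\Gamma(a)\in\mathbb{R}^{m\times m}$ and a column vector $\kappa(a)\in\mathbb{R}^m$ for each action $a\in A$, such that $X(a)=\Gamma(a)\big(\lambda_z u(a)+d_z\big)+\kappa(a)\mathbf{1}$ whenever $a$ is a vertex of $B_z$. -/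

import Mathlib

namespace BeliefElicitation

noncomputable section

/-! ### Graph notions: cut-vertices, blocks, minimum cycle bases -/

section Graph

variable {V : Type*}

/-- `v` is a cut-vertex of the (connected) subgraph `H` if deleting `v` disconnects `H`.
`Preconnected` is used so that deleting the only vertex of a one-point graph, which leaves the
empty graph, does not count as disconnecting it. -/
def IsCutVertex {G : SimpleGraph V} (H : G.Subgraph) (v : V) : Prop :=
  v ∈ H.verts ∧ ¬ (H.deleteVerts {v}).Preconnected

/-- A block of `G` is a maximal connected subgraph without cut-vertices. -/
def IsBlock {G : SimpleGraph V} (B : G.Subgraph) : Prop :=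
  Maximal (fun H : G.Subgraph => H.Connected ∧ ∀ v, ¬ IsCutVertex H v) B

/-- Every edge of `G` is given an arbitrary orientation, from `edgeTail` to `edgeHead`. -/
def edgeTail {G : SimpleGraph V} (e : G.edgeSet) : V := (Quot.out e.1).1

/-- The other endpoint of the edge in the chosen orientation. -/
def edgeHead {G : SimpleGraph V} (e : G.edgeSet) : V := (Quot.out e.1).2

open Classical in
/-- The vertex-edge incidence matrix: `+1` if `e` enters `v`, `-1` if `e` leaves `v`. -/
def incidenceMatrix (G : SimpleGraph V) : Matrix V G.edgeSet ℝ := fun v e =>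
  if v = edgeHead e then 1 else if v = edgeTail e then -1 else 0

open Classical in
/-- The cycle space of a finite graph: the kernel of its incidence matrix. -/
def cycleSpace [Fintype V] (G : SimpleGraph V) : Submodule ℝ (G.edgeSet → ℝ) :=
  LinearMap.ker (incidenceMatrix G).mulVecLin

/-- A (simple) cycle of `G`, with a base point and a direction. -/
structure GraphCycle (G : SimpleGraph V) where
  base : V
  walk : G.Walk base base
  isCycle : walk.IsCycle

/-- `C.Traverses a b` says that `C` runs through the edge `{a, b}` from `a` to `b`. -/
def GraphCycle.Traverses {G : SimpleGraph V} (C : GraphCycle G) (a b : V) : Prop :=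
  ∃ δ ∈ C.walk.darts, δ.fst = a ∧ δ.snd = b

/-- The number of edges of a cycle. -/
def GraphCycle.length {G : SimpleGraph V} (C : GraphCycle G) : ℕ := C.walk.length

open Classical in
/-- The incidence vector of a cycle: `+1` on the edges that it runs through along their
orientation, `-1` on those that it runs through against it, and `0` on all others. -/
def GraphCycle.vec {G : SimpleGraph V} (C : GraphCycle G) : G.edgeSet → ℝ := fun e =>
  if C.Traverses (edgeTail e) (edgeHead e) then 1
  else if C.Traverses (edgeHead e) (edgeTail e) then -1 else 0

/-- A cycle basis: a set of cycles whose incidence vectors form a basis of the cycle space. -/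
def IsCycleBasis [Fintype V] (G : SimpleGraph V) (S : Finset (GraphCycle G)) : Prop :=
  LinearIndependent ℝ (fun C : {C : GraphCycle G // C ∈ S} => C.1.vec) ∧
    Submodule.span ℝ (GraphCycle.vec '' {C : GraphCycle G | C ∈ S}) = cycleSpace G

/-- A minimum cycle basis: a cycle basis of least total length. -/
def IsMinCycleBasis [Fintype V] (G : SimpleGraph V) (S : Finset (GraphCycle G)) : Prop :=
  IsCycleBasis G S ∧
    ∀ T : Finset (GraphCycle G), IsCycleBasis G T → ∑ C ∈ S, C.length ≤ ∑ C ∈ T, C.length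

end Graph

/-! ### Belief elicitation

`Θ` is the set of states, `A` the set of actions, `u a θ` the task payoff, and beliefs are the
points of `stdSimplex ℝ Θ`. -/

section Model

variable {Θ A : Type*} [Fintype Θ]

/-- The set of (global) maximizers of a function. -/
def argMax {α : Type*} (f : α → ℝ) : Set α := {x | ∀ y, f y ≤ f x}

/-- The actions that maximize the expected task payoff under `p`. -/
def optimalActions (u : A → Θ → ℝ) (p : Θ → ℝ) : Set A :=
  argMax fun a => ∑ θ, p θ * u a θ

/-- A question profile `X` with `m` questions is incentivizable for the task `u` if some
elicitation method `W` with values in `[0, 1]` has as its optimal pairs (report, action), under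
every belief, precisely the truthful reports together with the optimal actions of the task. -/
def Incentivizable {m : ℕ} (u : A → Θ → ℝ) (X : A → Matrix (Fin m) Θ ℝ) : Prop :=
  ∃ W : (Fin m → ℝ) → A → Θ → ℝ,
    (∀ r a θ, W r a θ ∈ Set.Icc (0 : ℝ) 1) ∧
    ∀ p ∈ stdSimplex ℝ Θ,
      argMax (fun x : (Fin m → ℝ) × A => ∑ θ, p θ * W x.1 x.2 θ) =
        {x | x.2 ∈ optimalActions u p ∧ x.1 = (X x.2).mulVec p}

/-- Robust (joint) incentivizability. -/
def RobustlyIncentivizable {m : ℕ} (u : A → Θ → ℝ) (X : A → Matrix (Fin m) Θ ℝ) : Prop :=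
  ∃ μ : A → Matrix (Fin m) (Fin m) ℝ,
    (∀ a, IsUnit (μ a)) ∧
    ∀ t : Matrix (Fin m) Θ ℝ, Incentivizable u (fun a => X a + μ a * t)

/-- The adjacency graph of the task: two distinct actions are adjacent if under some belief they
are precisely the optimal actions. -/
def adjacencyGraph (u : A → Θ → ℝ) : SimpleGraph A where
  Adj a b := a ≠ b ∧ ∃ p ∈ stdSimplex ℝ Θ, optimalActions u p = {a, b}
  symm := ⟨fun a b h => ⟨h.1.symm, h.2.imp fun _ hp => ⟨hp.1, by rw [hp.2, Set.pair_comm]⟩⟩⟩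
  loopless := ⟨fun _ h => h.1 rfl⟩

/-- The projection of `v` to the vectors whose coordinates sum to zero. -/
def centered (v : Θ → ℝ) : Θ → ℝ := fun θ => v θ - (∑ θ', v θ') / Fintype.card Θ

/-- The payoff difference vector of the step from `a` to `b`. -/
def payoffDiff (u : A → Θ → ℝ) (a b : A) : Θ → ℝ := centered (u b) - centered (u a)

/-- No redundant actions: an action that is optimal under some belief is the only optimal action
under some belief. -/
def NoRedundantActions (u : A → Θ → ℝ) : Prop :=
  ∀ a, (∃ p ∈ stdSimplex ℝ Θ, a ∈ optimalActions u p) →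
    ∃ p ∈ stdSimplex ℝ Θ, optimalActions u p = {a}

/-- The independence assumption: the adjacency graph has a minimum cycle basis such that the
payoff difference vectors along each of its cycles `C` have rank `|C| - 1`. -/
def CycleIndependence [Fintype A] (u : A → Θ → ℝ) : Prop :=
  ∃ S : Finset (GraphCycle (adjacencyGraph u)), IsMinCycleBasis (adjacencyGraph u) S ∧
    ∀ C ∈ S, Module.finrank ℝ
      (Submodule.span ℝ {v : Θ → ℝ | ∃ a b, C.Traverses a b ∧ v = payoffDiff u a b}) + 1
        = C.length

/-- Blockwise joint alignment: `X(a) = Γ(a) (λ_B u(a) + d_B) + κ(a) 𝟏` for all actions `a` of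
each block `B`, where `λ_B u(a)` is the product of a column and a row. -/
def BlockwiseJointlyAligned {m : ℕ} (u : A → Θ → ℝ) (X : A → Matrix (Fin m) Θ ℝ) : Prop :=
  ∃ (lam : {B : (adjacencyGraph u).Subgraph // IsBlock B} → Fin m → ℝ)
    (d : {B : (adjacencyGraph u).Subgraph // IsBlock B} → Matrix (Fin m) Θ ℝ)
    (Γ : A → Matrix (Fin m) (Fin m) ℝ) (κ : A → Fin m → ℝ),
    (∀ a, IsUnit (Γ a)) ∧
    ∀ B, ∀ a ∈ B.1.verts,
      X a = Γ a * (Matrix.vecMulVec (lam B) (u a) + d B) + Matrix.vecMulVec (κ a) 1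

end Model

end

end BeliefElicitation

namespace BeliefElicitation

/-! ### Linear algebra -/

/-! Necessity. Put `Y a = (μ a)⁻¹ * X a`. The shift `t = -Y a` makes the answer at `a` trivial. Near
a full-support belief where exactly `a` and a neighbour `b` tie, linearity of expected payoffs then
makes the answer at `b` a function of the payoff difference alone (`Incentivizable.row_eq_of_adj`).
Hence each edge carries coefficients with `Y b - Y a = v (u b - u a) + w 𝟏`. Centering removes `w`,
and summing around a basis cycle gives a linear relation among the payoff differences; the rank
assumption leaves a one-dimensional space of relations, so `v` is constant on the cycle
(`GraphCycle.constant_of_rank`), hence on each block (`IsCycleBasis.constant_on_block`). Then `w`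
has no circulation either, so it is the gradient of a potential, which supplies `κ`.

Sufficiency. Reward the answer to `Y a` by a small quadratic score, so that action `a` with a
truthful answer is worth `p ⬝ᵥ u a + ε |Y a p|²`. Alignment makes the change of this value along an
edge equal to the change of task payoff times a factor close to one. An action that is suboptimal
under `p` but optimal somewhere has a better neighbour (`NoRedundantActions.exists_adj_lt`), so the
new value has the same maximizers as the task. -/

theorem exists_eq_sum_smul_of_orthogonal {ι κ : Type*} [Fintype ι] [Fintype κ]
    (L : ι → κ → ℝ) (y : κ → ℝ)
    (h : ∀ z : κ → ℝ, (∀ i, L i ⬝ᵥ z = 0) → y ⬝ᵥ z = 0) :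
    ∃ c : ι → ℝ, ∀ k, y k = ∑ i, c i * L i k := by
  classical
  have key := mem_span_of_iInf_ker_le_ker (L := fun i => dotProductBilin ℝ ℝ (L i))
    (K := dotProductBilin ℝ ℝ y) (by
      intro z hz
      simp only [Submodule.mem_iInf, LinearMap.mem_ker] at hz ⊢
      exact h z hz)
  obtain ⟨c, hc⟩ := (Submodule.mem_span_range_iff_exists_fun ℝ).1 key
  refine ⟨c, fun k => ?_⟩
  have := congrArg (fun f : (κ → ℝ) →ₗ[ℝ] ℝ => f (Pi.single k 1)) hc
  simpa using this.symm

/-! ### Graphs -/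

section Graph

variable {V : Type*} {G : SimpleGraph V}

theorem eq_of_preconnected {α : Type*} {H : G.Subgraph} (hH : H.Preconnected) (g : V → α)
    (hg : ∀ a b, H.Adj a b → g a = g b) {a b : V} (ha : a ∈ H.verts) (hb : b ∈ H.verts) :
    g a = g b := by
  obtain ⟨p⟩ := hH.coe ⟨a, ha⟩ ⟨b, hb⟩
  have key : ∀ x y : H.verts, H.coe.Walk x y → g x = g y := by
    intro x y p
    induction p with
    | nil => rfl
    | cons h _ ih => exact (hg _ _ h).trans ih
  exact key _ _ p

theorem edge_eq (e : G.edgeSet) : s(edgeTail e, edgeHead e) = e.1 := Quot.out_eq e.1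

theorem edge_adj (e : G.edgeSet) : G.Adj (edgeTail e) (edgeHead e) := by
  have := e.2
  rwa [← edge_eq e, SimpleGraph.mem_edgeSet] at this

/-- A single edge has no cut-vertex, so it extends to a maximal such subgraph. Through this lemma,
blockwise alignment becomes a condition on edges. -/
theorem exists_isBlock_of_adj [Finite V] {a b : V} (h : G.Adj a b) :
    ∃ B : G.Subgraph, IsBlock B ∧ a ∈ B.verts ∧ b ∈ B.verts := by
  have h0 : (G.subgraphOfAdj h).Connected ∧ ∀ v, ¬ IsCutVertex (G.subgraphOfAdj h) v := by
    refine ⟨SimpleGraph.Subgraph.subgraphOfAdj_connected h, ?_⟩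
    rintro v ⟨hv, hn⟩
    apply hn
    refine ⟨?_⟩
    rintro ⟨x, hx⟩ ⟨y, hy⟩
    have : x = y := by
      simp at hx hy hv
      grind
    subst this
    exact SimpleGraph.Reachable.refl _
  obtain ⟨B, hle, hB⟩ := Finite.exists_le_maximal
    (p := fun H : G.Subgraph => H.Connected ∧ ∀ v, ¬ IsCutVertex H v) h0
  exact ⟨B, hB, hle.1 (by simp), hle.1 (by simp)⟩

/-! ### Cycle space, potentials and blocks -/

open Classical in
theorem sum_mul_incidenceMatrix [Fintype V] (f : V → ℝ) (e : G.edgeSet) :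
    ∑ a, f a * incidenceMatrix G a e = f (edgeHead e) - f (edgeTail e) := by
  have hne : edgeTail e ≠ edgeHead e := (edge_adj e).ne
  have : ∀ a, f a * incidenceMatrix G a e =
      (if a = edgeHead e then f a else 0) - (if a = edgeTail e then f a else 0) := by
    intro a
    unfold incidenceMatrix
    split_ifs <;> simp_all
  simp [this, Finset.sum_sub_distrib]

theorem mem_cycleSpace_iff [Fintype V] [inst : Fintype G.edgeSet] (x : G.edgeSet → ℝ) :
    x ∈ cycleSpace G ↔ ∀ a, incidenceMatrix G a ⬝ᵥ x = 0 := by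
  classical
  -- `cycleSpace` carries its own classical `Fintype` instance on the edges, which has to be
  -- identified with `inst`.
  have key : ∀ i : Fintype G.edgeSet,
      (x ∈ @LinearMap.ker _ _ _ _ _ _ _ _ _ _ _ (@Matrix.mulVecLin _ _ _ _ i
        (incidenceMatrix G)) ↔ ∀ a, @dotProduct _ _ inst _ _ (incidenceMatrix G a) x = 0) := by
    intro i
    obtain rfl : i = inst := Subsingleton.elim _ _
    exact funext_iff
  exact key _

theorem sum_mul_sub_eq_zero [Fintype V] [Fintype G.edgeSet] {x : G.edgeSet → ℝ}
    (hx : x ∈ cycleSpace G) (f : V → ℝ) :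
    ∑ e, x e * (f (edgeHead e) - f (edgeTail e)) = 0 := by
  rw [mem_cycleSpace_iff] at hx
  calc ∑ e, x e * (f (edgeHead e) - f (edgeTail e))
      = ∑ e, ∑ a, f a * (incidenceMatrix G a e * x e) := by
        refine Finset.sum_congr rfl fun e _ => ?_
        rw [← sum_mul_incidenceMatrix, Finset.mul_sum]
        exact Finset.sum_congr rfl fun a _ => by ring
    _ = ∑ a, f a * (incidenceMatrix G a ⬝ᵥ x) := by
        rw [Finset.sum_comm]
        simp [dotProduct, Finset.mul_sum]
    _ = 0 := by simp [hx]

theorem IsCycleBasis.vec_mem [Fintype V] {S : Finset (GraphCycle G)} (hS : IsCycleBasis G S)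
    {C : GraphCycle G} (hC : C ∈ S) : C.vec ∈ cycleSpace G := by
  rw [← hS.2]
  exact Submodule.subset_span ⟨C, hC, rfl⟩

/-- Orthogonality to the basis cycles is orthogonality to the kernel of the incidence matrix, so `w`
lies in its row space; the row coefficients are the potential. -/
theorem IsCycleBasis.exists_potential [Fintype V] [Fintype G.edgeSet]
    {S : Finset (GraphCycle G)} (hS : IsCycleBasis G S) (w : G.edgeSet → ℝ)
    (hw : ∀ C ∈ S, ∑ e, C.vec e * w e = 0) :
    ∃ k : V → ℝ, ∀ e, w e = k (edgeHead e) - k (edgeTail e) := by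
  obtain ⟨k, hk⟩ := exists_eq_sum_smul_of_orthogonal (incidenceMatrix G) w (by
    intro z hz
    have hz' : z ∈ cycleSpace G := (mem_cycleSpace_iff z).2 hz
    rw [← hS.2] at hz'
    have hle : Submodule.span ℝ (GraphCycle.vec '' {C : GraphCycle G | C ∈ S}) ≤
        LinearMap.ker (dotProductBilin ℝ ℝ w) := by
      rw [Submodule.span_le]
      rintro _ ⟨C, hC, rfl⟩
      simpa [dotProduct, mul_comm] using hw C hC
    exact hle hz')
  exact ⟨k, fun e => by rw [hk e, sum_mul_incidenceMatrix]⟩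

/-- Multiplying a gradient by `v` keeps it orthogonal to the basis cycles, hence a gradient. For the
indicator of a vertex `x`, the resulting potential is constant on the block minus `x`, which is
connected; so `v` agrees on all block edges at `x`. Connectedness of the block spreads the common
value. -/
theorem IsCycleBasis.constant_on_block [Fintype V] [Fintype G.edgeSet]
    {S : Finset (GraphCycle G)} (hS : IsCycleBasis G S) (v : Sym2 V → ℝ)
    (hv : ∀ C ∈ S, ∃ c, ∀ e : G.edgeSet, C.vec e ≠ 0 → v e.1 = c)
    {B : G.Subgraph} (hB : IsBlock B) :
    ∃ c, ∀ a b, B.Adj a b → v s(a, b) = c := by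
  classical
  have hgrad : ∀ f : V → ℝ, ∃ g : V → ℝ, ∀ a b, G.Adj a b →
      g b - g a = v s(a, b) * (f b - f a) := by
    intro f
    obtain ⟨g, hg⟩ := hS.exists_potential
      (fun e => v e.1 * (f (edgeHead e) - f (edgeTail e))) (by
        intro C hC
        obtain ⟨c, hc⟩ := hv C hC
        have := sum_mul_sub_eq_zero (hS.vec_mem hC) f
        calc _ = c * ∑ e, C.vec e * (f (edgeHead e) - f (edgeTail e)) := by
              rw [Finset.mul_sum]
              refine Finset.sum_congr rfl fun e _ => ?_
              by_cases h0 : C.vec e = 0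
              · simp [h0]
              · rw [hc e h0]; ring
          _ = 0 := by rw [this, mul_zero])
    refine ⟨g, fun a b hab => ?_⟩
    have he := edge_eq (⟨s(a, b), hab⟩ : G.edgeSet)
    have hge := hg ⟨s(a, b), hab⟩
    rcases Sym2.eq_iff.1 he with ⟨h1, h2⟩ | ⟨h1, h2⟩
    · rw [h1, h2] at hge
      exact hge.symm
    · rw [h1, h2] at hge
      linear_combination hge
  have hvert : ∀ x a b, B.Adj x a → B.Adj x b → v s(x, a) = v s(x, b) := by
    intro x a b ha hb
    obtain ⟨g, hg⟩ := hgrad (Pi.single x 1)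
    have hcon : (B.deleteVerts {x}).Preconnected := by
      by_contra hn
      exact hB.prop.2 x ⟨ha.fst_mem, hn⟩
    have hgab : g a = g b := by
      refine eq_of_preconnected hcon g ?_ ?_ ?_
      · intro y z hyz
        rw [SimpleGraph.Subgraph.deleteVerts_adj] at hyz
        obtain ⟨-, hy, -, hz, hyz⟩ := hyz
        have := hg y z hyz.adj_sub
        rw [Pi.single_eq_of_ne (by simpa using hz), Pi.single_eq_of_ne (by simpa using hy)] at this
        linarith
      · exact ⟨ha.snd_mem, by simpa using ha.adj_sub.ne'⟩
      · exact ⟨hb.snd_mem, by simpa using hb.adj_sub.ne'⟩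
    have h1 := hg x a ha.adj_sub
    have h2 := hg x b hb.adj_sub
    rw [Pi.single_eq_same, Pi.single_eq_of_ne ha.adj_sub.ne'] at h1
    rw [Pi.single_eq_same, Pi.single_eq_of_ne hb.adj_sub.ne'] at h2
    linarith
  by_cases hne : ∃ a b, B.Adj a b
  · obtain ⟨a, b, hab⟩ := hne
    refine ⟨v s(a, b), fun x y hxy => ?_⟩
    have hstep : ∀ x y, B.Adj x y → (∀ z, B.Adj x z → v s(x, z) = v s(a, b)) →
        ∀ z, B.Adj y z → v s(y, z) = v s(a, b) := by
      intro x y hxy hx z hz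
      rw [hvert y z x hz hxy.symm, Sym2.eq_swap]
      exact hx y hxy
    have := eq_of_preconnected hB.prop.1.preconnected
      (fun x => ∀ z, B.Adj x z → v s(x, z) = v s(a, b))
      (fun x y h => propext ⟨hstep x y h, hstep y x h.symm⟩) hab.fst_mem hxy.fst_mem
    exact this.mp (fun z hz => hvert a z b hz hab) y hxy
  · exact ⟨0, fun a b h => (hne ⟨a, b, h⟩).elim⟩

/-- If vectors attached to the edges sum to zero along a cycle and have rank at least one less
than its length, every linear relation between them along the cycle has constant coefficients. -/
theorem GraphCycle.constant_of_rank [Fintype G.edgeSet] {Θ : Type*} [Fintype Θ]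
    (C : GraphCycle G) (x : V → Θ → ℝ)
    (hrank : C.length ≤ Module.finrank ℝ
      (Submodule.span ℝ {y : Θ → ℝ | ∃ a b, C.Traverses a b ∧ y = x b - x a}) + 1)
    (hsum : ∑ e, C.vec e • (x (edgeHead e) - x (edgeTail e)) = 0)
    (v : G.edgeSet → ℝ)
    (hv : ∑ e, (v e * C.vec e) • (x (edgeHead e) - x (edgeTail e)) = 0) :
    ∃ c, ∀ e, C.vec e ≠ 0 → v e = c := by
  classical
  set E : Finset G.edgeSet := Finset.univ.filter fun e => C.vec e ≠ 0 with hE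
  let y : E → Θ → ℝ := fun e => C.vec e • (x (edgeHead e.1) - x (edgeTail e.1))
  let Φ : (E → ℝ) →ₗ[ℝ] (Θ → ℝ) := Fintype.linearCombination ℝ y
  have hmem : ∀ e ∈ E, e.1 ∈ C.walk.edges := by
    intro e he
    have h0 : C.vec e ≠ 0 := (Finset.mem_filter.1 he).2
    unfold GraphCycle.vec at h0
    have : C.Traverses (edgeTail e) (edgeHead e) ∨ C.Traverses (edgeHead e) (edgeTail e) := by
      by_contra hcon
      push Not at hcon
      simp [hcon.1, hcon.2] at h0
    rw [← edge_eq e]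
    rcases this with ⟨δ, hδ, h1, h2⟩ | ⟨δ, hδ, h1, h2⟩
    · rw [← h1, ← h2]
      exact List.mem_map.2 ⟨δ, hδ, rfl⟩
    · rw [← h1, ← h2, Sym2.eq_swap]
      exact List.mem_map.2 ⟨δ, hδ, rfl⟩
  have hcard : E.card ≤ C.length := by
    calc E.card = (E.image Subtype.val).card :=
          (Finset.card_image_of_injective _ Subtype.val_injective).symm
      _ ≤ C.walk.edges.toFinset.card := by
          refine Finset.card_le_card fun e he => ?_
          obtain ⟨e', he', rfl⟩ := Finset.mem_image.1 he
          exact List.mem_toFinset.2 (hmem e' he')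
      _ ≤ C.walk.edges.length := List.toFinset_card_le _
      _ = C.length := C.walk.length_edges
  -- The chosen edge orientations affect only signs, which a span does not see.
  have hspan : Submodule.span ℝ {y : Θ → ℝ | ∃ a b, C.Traverses a b ∧ y = x b - x a} ≤
      LinearMap.range Φ := by
    rw [Submodule.span_le]
    rintro _ ⟨a, b, hab, rfl⟩
    have hadj : G.Adj a b := by
      obtain ⟨δ, -, h1, h2⟩ := hab
      rw [← h1, ← h2]
      exact δ.adj
    let e : G.edgeSet := ⟨s(a, b), hadj⟩
    have hor := Sym2.eq_iff.1 (edge_eq e)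
    have hvec : C.vec e ≠ 0 := by
      unfold GraphCycle.vec
      rcases hor with ⟨h1, h2⟩ | ⟨h1, h2⟩
      · rw [h1, h2, if_pos hab]; norm_num
      · rw [h1, h2]
        split_ifs <;> norm_num
    have heE : e ∈ E := Finset.mem_filter.2 ⟨Finset.mem_univ _, hvec⟩
    have hy : (C.vec e)⁻¹ • y ⟨e, heE⟩ = x (edgeHead e) - x (edgeTail e) := by
      simp only [y, smul_smul, inv_mul_cancel₀ hvec, one_smul]
    have hyr : y ⟨e, heE⟩ ∈ LinearMap.range Φ := ⟨Pi.single ⟨e, heE⟩ 1, by simp [Φ]⟩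
    have hr := (LinearMap.range Φ).smul_mem (C.vec e)⁻¹ hyr
    rw [hy] at hr
    rcases hor with ⟨h1, h2⟩ | ⟨h1, h2⟩
    · rwa [h1, h2] at hr
    · rw [h1, h2] at hr
      simpa using neg_mem hr
  have hker : Module.finrank ℝ (LinearMap.ker Φ) ≤ 1 := by
    have h1 := LinearMap.finrank_range_add_finrank_ker Φ
    have h2 := Submodule.finrank_mono hspan
    rw [Module.finrank_fintype_fun_eq_card, Fintype.card_coe] at h1
    omega
  have hΦ : ∀ c : G.edgeSet → ℝ, Φ (fun e => c e) =
      ∑ e, (c e * C.vec e) • (x (edgeHead e) - x (edgeTail e)) := by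
    intro c
    have : Φ (fun e => c e) =
        ∑ e ∈ E, (c e * C.vec e) • (x (edgeHead e) - x (edgeTail e)) := by
      rw [← Finset.sum_coe_sort E]
      simp [Φ, y, Fintype.linearCombination_apply, smul_smul]
    rw [this]
    refine Finset.sum_subset (Finset.subset_univ _) fun e _ he => ?_
    have : C.vec e = 0 := by
      by_contra h
      exact he (Finset.mem_filter.2 ⟨Finset.mem_univ _, h⟩)
    simp [this]
  -- The kernel is at most a line and contains the all-ones vector, so `v` on the support of `C` is
  -- a multiple of it.
  obtain ⟨k, hk⟩ := finrank_le_one_iff.1 hker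
  obtain ⟨c₁, hc₁⟩ := hk ⟨fun _ => 1, by
    rw [LinearMap.mem_ker, hΦ (fun _ => 1)]; simpa using hsum⟩
  obtain ⟨c₂, hc₂⟩ := hk ⟨fun e => v e, by rw [LinearMap.mem_ker, hΦ]; exact hv⟩
  refine ⟨c₂ / c₁, fun e he => ?_⟩
  have heE : e ∈ E := Finset.mem_filter.2 ⟨Finset.mem_univ _, he⟩
  have e₁ : c₁ * k.1 ⟨e, heE⟩ = 1 := congrFun (congrArg Subtype.val hc₁) ⟨e, heE⟩
  have e₂ : c₂ * k.1 ⟨e, heE⟩ = v e := congrFun (congrArg Subtype.val hc₂) ⟨e, heE⟩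
  have hc : c₁ ≠ 0 := by
    rintro rfl
    simp at e₁
  rw [eq_div_iff hc, ← e₂]
  linear_combination c₂ * e₁

end Graph

/-! ### Optimal actions on the cone of nonnegative weights -/

section Model

variable {Θ A : Type*} [Fintype Θ]

theorem mem_optimalActions {u : A → Θ → ℝ} {p : Θ → ℝ} {a : A} :
    a ∈ optimalActions u p ↔ ∀ c, p ⬝ᵥ u c ≤ p ⬝ᵥ u a := Iff.rfl

theorem optimalActions_smul (u : A → Θ → ℝ) (p : Θ → ℝ) {k : ℝ} (hk : 0 < k) :
    optimalActions u (k • p) = optimalActions u p := by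
  ext a
  simp only [mem_optimalActions, smul_dotProduct, smul_eq_mul]
  exact forall_congr' fun c => mul_le_mul_iff_right₀ hk

theorem optimalActions_eq_singleton_iff {u : A → Θ → ℝ} {p : Θ → ℝ} {a : A} :
    optimalActions u p = {a} ↔ ∀ c, c ≠ a → p ⬝ᵥ u c < p ⬝ᵥ u a := by
  constructor
  · intro h c hc
    have ha : a ∈ optimalActions u p := h ▸ rfl
    refine lt_of_le_of_ne (mem_optimalActions.1 ha c) fun heq => hc ?_
    have : c ∈ optimalActions u p := mem_optimalActions.2 fun d => heq ▸ mem_optimalActions.1 ha d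
    rwa [h] at this
  · intro h
    ext c
    rw [Set.mem_singleton_iff]
    constructor
    · intro hc
      by_contra hne
      exact absurd (mem_optimalActions.1 hc a) (not_le.2 (h c hne))
    · rintro rfl
      refine mem_optimalActions.2 fun d => ?_
      by_cases hd : d = c
      · rw [hd]
      · exact (h d hd).le

theorem optimalActions_eq_pair_iff {u : A → Θ → ℝ} {p : Θ → ℝ} {a b : A} :
    optimalActions u p = {a, b} ↔
      p ⬝ᵥ u a = p ⬝ᵥ u b ∧ ∀ c, c ≠ a → c ≠ b → p ⬝ᵥ u c < p ⬝ᵥ u a := by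
  constructor
  · intro h
    have ha : a ∈ optimalActions u p := h ▸ Set.mem_insert _ _
    have hb : b ∈ optimalActions u p := h ▸ Set.mem_insert_of_mem _ rfl
    refine ⟨le_antisymm (hb a) (ha b), fun c hca hcb => ?_⟩
    refine lt_of_le_of_ne (ha c) fun heq => ?_
    have : c ∈ optimalActions u p := mem_optimalActions.2 fun d => heq ▸ ha d
    rw [h] at this
    rcases this with h | h
    · exact hca h
    · exact hcb h
  · rintro ⟨hab, h⟩
    ext c
    simp only [Set.mem_insert_iff, Set.mem_singleton_iff]
    constructor
    · intro hc
      by_contra hne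
      push Not at hne
      exact absurd (mem_optimalActions.1 hc a) (not_le.2 (h c hne.1 hne.2))
    · have key : ∀ d, p ⬝ᵥ u d ≤ p ⬝ᵥ u a := by
        intro d
        by_cases hd : d = a
        · rw [hd]
        · by_cases hd' : d = b
          · rw [hd', hab]
          · exact (h d hd hd').le
      rintro (rfl | rfl)
      · exact key
      · exact mem_optimalActions.2 fun d => hab ▸ key d

theorem inv_sum_smul_mem_stdSimplex {q : Θ → ℝ} (hq : ∀ θ, 0 ≤ q θ) (hs : 0 < ∑ θ, q θ) :
    (∑ θ, q θ)⁻¹ • q ∈ stdSimplex ℝ Θ := by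
  refine ⟨fun θ => mul_nonneg (inv_nonneg.2 hs.le) (hq θ), ?_⟩
  simp only [Pi.smul_apply, smul_eq_mul, ← Finset.mul_sum]
  exact inv_mul_cancel₀ hs.ne'

theorem adjacencyGraph_adj_of_cone {u : A → Θ → ℝ} {a b : A} (hab : a ≠ b) {q : Θ → ℝ}
    (hq : ∀ θ, 0 ≤ q θ) (hs : 0 < ∑ θ, q θ) (h : optimalActions u q = {a, b}) :
    (adjacencyGraph u).Adj a b :=
  ⟨hab, _, inv_sum_smul_mem_stdSimplex hq hs, by
    rw [optimalActions_smul _ _ (inv_pos.2 hs), h]⟩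

theorem NoRedundantActions.exists_unique_of_cone {u : A → Θ → ℝ} (hred : NoRedundantActions u)
    {q : Θ → ℝ} (hq : ∀ θ, 0 ≤ q θ) (hs : 0 < ∑ θ, q θ) {a : A}
    (ha : a ∈ optimalActions u q) :
    ∃ p ∈ stdSimplex ℝ Θ, optimalActions u p = {a} :=
  hred a ⟨_, inv_sum_smul_mem_stdSimplex hq hs, by rwa [optimalActions_smul _ _ (inv_pos.2 hs)]⟩

theorem eventually_pos_add_mul {a b : ℝ} (ha : 0 < a) : ∀ᶠ s in nhds (0 : ℝ), 0 < a + s * b := by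
  have : ContinuousAt (fun s : ℝ => a + s * b) 0 := by fun_prop
  exact this.eventually (lt_mem_nhds (by simpa using ha))

theorem exists_pos_of_eventually {P : ℝ → Prop} (h : ∀ᶠ s in nhds (0 : ℝ), P s) :
    ∃ s > 0, P s ∧ P (-s) := by
  obtain ⟨ε, hε, h⟩ := Metric.eventually_nhds_iff.1 h
  refine ⟨ε / 2, by positivity, h ?_, h ?_⟩ <;>
  · simp [abs_of_pos hε]
    linarith

theorem dense_dotProduct_ne_zero {l : Θ → ℝ} (hl : l ≠ 0) :
    Dense {q : Θ → ℝ | q ⬝ᵥ l ≠ 0} := by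
  have hW : LinearMap.ker (dotProductBilin ℝ ℝ l) ≠ ⊤ := by
    intro h
    apply hl
    have : l ∈ LinearMap.ker (dotProductBilin ℝ ℝ l) := h ▸ Submodule.mem_top
    exact dotProduct_self_eq_zero.1 this
  have hint : interior (LinearMap.ker (dotProductBilin ℝ ℝ l) : Set (Θ → ℝ)) = ∅ := by
    by_contra h
    exact hW (Submodule.eq_top_of_nonempty_interior' _ (Set.nonempty_iff_ne_empty.2 h))
  convert interior_eq_empty_iff_dense_compl.1 hint using 1
  ext q
  simp [dotProduct_comm]

/-- A local improvement: an action that is optimal somewhere but not under `p` has a neighbour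
in the adjacency graph that is better under `p`. -/
theorem NoRedundantActions.exists_adj_lt [Finite A] {u : A → Θ → ℝ}
    (hred : NoRedundantActions u) {b : A} (hb : ∃ p ∈ stdSimplex ℝ Θ, b ∈ optimalActions u p)
    {p : Θ → ℝ} (hp : p ∈ stdSimplex ℝ Θ) (hbp : b ∉ optimalActions u p) :
    ∃ c, (adjacencyGraph u).Adj b c ∧ p ⬝ᵥ u b < p ⬝ᵥ u c := by
  have : Fintype A := Fintype.ofFinite A
  have hΘ : Nonempty Θ := by
    by_contra h
    rw [not_nonempty_iff] at h
    simpa using hp.2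
  obtain ⟨p₀, hp₀, h₀⟩ := hred b hb
  rw [optimalActions_eq_singleton_iff] at h₀
  let α : A → ℝ := fun c => p ⬝ᵥ u c - p ⬝ᵥ u b
  let l : A × A → Θ → ℝ := fun x => α x.2 • (u b - u x.1) - α x.1 • (u b - u x.2)
  let U : Set (Θ → ℝ) := {q | (∀ θ, 0 < q θ) ∧ ∀ c, c ≠ b → q ⬝ᵥ u c < q ⬝ᵥ u b}
  have hUopen : IsOpen U := by
    have h1 : IsOpen {q : Θ → ℝ | ∀ θ, 0 < q θ} := by
      simp only [Set.ofPred_forall]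
      exact isOpen_iInter_of_finite fun θ => isOpen_lt continuous_const (continuous_apply θ)
    have h2 : IsOpen {q : Θ → ℝ | ∀ c, c ≠ b → q ⬝ᵥ u c < q ⬝ᵥ u b} := by
      simp only [Set.ofPred_forall]
      refine isOpen_iInter_of_finite fun c => isOpen_iInter_of_finite fun _ => ?_
      exact isOpen_lt (by fun_prop) (by fun_prop)
    exact h1.inter h2
  have hUne : U.Nonempty := by
    have : ∀ᶠ s in nhds (0 : ℝ), ∀ c, c ≠ b →
        0 < (p₀ ⬝ᵥ u b - p₀ ⬝ᵥ u c) + s * ((1 : Θ → ℝ) ⬝ᵥ u b - (1 : Θ → ℝ) ⬝ᵥ u c) := by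
      rw [Filter.eventually_all]
      intro c
      by_cases hc : c = b
      · simp [hc]
      · filter_upwards [eventually_pos_add_mul (sub_pos.2 (h₀ c hc))] with s hs _ using hs
    obtain ⟨s, hs, h, -⟩ := exists_pos_of_eventually this
    refine ⟨p₀ + s • 1, fun θ => ?_, fun c hc => ?_⟩
    · have := hp₀.1 θ
      simp
      linarith
    · have := h c hc
      simp only [add_dotProduct, smul_dotProduct, smul_eq_mul]
      linarith
  -- A generic `q` avoids the finitely many hyperplanes on which two actions catch up with `b` at
  -- the same point of the ray `q + ρ • p`.
  have hdense : Dense (⋂ x : A × A, {q : Θ → ℝ | l x = 0 ∨ q ⬝ᵥ l x ≠ 0}) := by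
    refine dense_iInter_of_isOpen (fun x => ?_) (fun x => ?_)
    · by_cases h : l x = 0
      · simp [h]
      · simp only [h, false_or]
        exact isOpen_ne_fun (by fun_prop) continuous_const
    · by_cases h : l x = 0
      · simp [h]
      · simp only [h, false_or]
        exact dense_dotProduct_ne_zero h
  obtain ⟨q, ⟨hqpos, hqb⟩, hqD⟩ := hdense.inter_open_nonempty U hUopen hUne
  simp only [Set.mem_iInter, Set.mem_ofPred_eq] at hqD
  let g : A → ℝ := fun c => q ⬝ᵥ u b - q ⬝ᵥ u c
  have hg : ∀ c, c ≠ b → 0 < g c := fun c hc => sub_pos.2 (hqb c hc)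
  have hαb : α b = 0 := sub_self _
  have hαne : ∀ c, 0 < α c → c ≠ b := by
    rintro c hc rfl
    exact absurd hαb hc.ne'
  classical
  have hN : (Finset.univ.filter fun c => 0 < α c).Nonempty := by
    by_contra h
    rw [Finset.not_nonempty_iff_eq_empty, Finset.filter_eq_empty_iff] at h
    refine hbp (mem_optimalActions.2 fun c => ?_)
    have := h (Finset.mem_univ c)
    simp only [α, sub_pos, not_lt] at this
    exact this
  -- `c` is the first action to catch up with `b` along the ray, at parameter `ρ`.
  obtain ⟨c, hcN, hcmin⟩ := Finset.exists_min_image _ (fun c => g c / α c) hN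
  replace hcN : 0 < α c := (Finset.mem_filter.1 hcN).2
  replace hcmin : ∀ c', 0 < α c' → g c / α c ≤ g c' / α c' := fun c' hc' =>
    hcmin c' (Finset.mem_filter.2 ⟨Finset.mem_univ _, hc'⟩)
  set ρ := g c / α c with hρ
  have hρpos : 0 < ρ := div_pos (hg c (hαne c hcN)) hcN
  let x : Θ → ℝ := q + ρ • p
  have hx : ∀ d, x ⬝ᵥ u b - x ⬝ᵥ u d = g d - ρ * α d := by
    intro d
    simp only [x, g, α, add_dotProduct, smul_dotProduct, smul_eq_mul]
    ring
  have hxpos : ∀ θ, 0 < x θ := fun θ =>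
    add_pos_of_pos_of_nonneg (hqpos θ) (mul_nonneg hρpos.le (hp.1 θ))
  have hxs : 0 < ∑ θ, x θ := Finset.sum_pos (fun θ _ => hxpos θ) Finset.univ_nonempty
  have hnn : ∀ d, 0 ≤ g d - ρ * α d := by
    intro d
    by_cases hd : 0 < α d
    · have := hcmin d hd
      rw [le_div_iff₀ hd] at this
      linarith
    · have h1 : 0 ≤ g d := by
        by_cases hdb : d = b
        · simp [g, hdb]
        · exact (hg d hdb).le
      nlinarith
  have hc0 : g c - ρ * α c = 0 := by
    rw [hρ, div_mul_cancel₀ _ hcN.ne', sub_self]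
  have hopt : ∀ d, g d - ρ * α d = 0 → d ∈ optimalActions u x := fun d hd =>
    mem_optimalActions.2 fun e => by
      have := hx e; have := hx d; have := hnn e
      linarith
  refine ⟨c, adjacencyGraph_adj_of_cone (hαne c hcN).symm (fun θ => (hxpos θ).le) hxs
    (optimalActions_eq_pair_iff.2 ⟨by have := hx c; linarith, fun d hdb hdc => ?_⟩),
    sub_pos.1 hcN⟩
  refine sub_pos.1 ((hx d).symm ▸ lt_of_le_of_ne (hnn d) fun hd0 => ?_)
  replace hd0 := hd0.symm
  have hdN : 0 < α d := by
    have := hg d hdb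
    by_contra h
    nlinarith
  -- A second tie `d` is possible only if `u b - u c` and `u b - u d` are proportional. Both `c` and
  -- `d` are uniquely optimal somewhere, which forces `α d < α c` and `α c < α d`.
  have hl : l (c, d) = 0 := by
    refine (hqD (c, d)).resolve_right (not_not.2 ?_)
    simp only [l, dotProduct_sub, dotProduct_smul, smul_eq_mul]
    change α d * g c - α c * g d = 0
    linear_combination α d * hc0 - α c * hd0
  have hprop : ∀ y : Θ → ℝ, α d * (y ⬝ᵥ u b - y ⬝ᵥ u c) = α c * (y ⬝ᵥ u b - y ⬝ᵥ u d) := by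
    intro y
    have : y ⬝ᵥ l (c, d) = 0 := by rw [hl, dotProduct_zero]
    simp only [l, dotProduct_sub, dotProduct_smul, smul_eq_mul] at this
    linarith
  obtain ⟨p₁, -, h₁⟩ := hred.exists_unique_of_cone (fun θ => (hxpos θ).le) hxs (hopt c hc0)
  obtain ⟨p₂, -, h₂⟩ := hred.exists_unique_of_cone (fun θ => (hxpos θ).le) hxs (hopt d hd0)
  rw [optimalActions_eq_singleton_iff] at h₁ h₂
  have e₁ := h₁ b (hαne c hcN).symm
  have e₂ := h₁ d hdc
  have e₃ := h₂ b hdb.symm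
  have e₄ := h₂ c (Ne.symm hdc)
  have i₁ := hprop p₁
  have i₂ := hprop p₂
  have j₁ : α d < α c := by
    by_contra! h
    nlinarith
  have j₂ : α c < α d := by
    by_contra! h
    nlinarith
  exact lt_asymm j₁ j₂

/-- Two adjacent actions are precisely the optimal ones under some belief of full support. -/
theorem NoRedundantActions.exists_interior_tie [Finite A] {u : A → Θ → ℝ}
    (hred : NoRedundantActions u) {a b : A} (hab : (adjacencyGraph u).Adj a b) :
    ∃ q ∈ stdSimplex ℝ Θ, (∀ θ, 0 < q θ) ∧ optimalActions u q = {a, b} := by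
  obtain ⟨hne, p, hp, hpo⟩ := hab
  have hΘ : Nonempty Θ := by
    by_contra h
    rw [not_nonempty_iff] at h
    simpa using hp.2
  have hpa : a ∈ optimalActions u p := hpo ▸ Set.mem_insert _ _
  have hpb : b ∈ optimalActions u p := hpo ▸ Set.mem_insert_of_mem _ rfl
  obtain ⟨pa, hpa0, hpa⟩ := hred a ⟨p, hp, hpa⟩
  obtain ⟨pb, hpb0, hpb⟩ := hred b ⟨p, hp, hpb⟩
  rw [optimalActions_eq_singleton_iff] at hpa hpb
  rw [optimalActions_eq_pair_iff] at hpo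
  have ha := sub_pos.2 (hpa b hne.symm)
  have hb := sub_pos.2 (hpb a hne)
  obtain ⟨s, hs, ⟨hsa, hsb⟩, -⟩ := exists_pos_of_eventually
    ((eventually_pos_add_mul (b := (1 : Θ → ℝ) ⬝ᵥ u a - (1 : Θ → ℝ) ⬝ᵥ u b) ha).and
      (eventually_pos_add_mul (b := (1 : Θ → ℝ) ⬝ᵥ u b - (1 : Θ → ℝ) ⬝ᵥ u a) hb))
  set k := (pa ⬝ᵥ u a - pa ⬝ᵥ u b) + s * ((1 : Θ → ℝ) ⬝ᵥ u a - (1 : Θ → ℝ) ⬝ᵥ u b) with hk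
  set k' := (pb ⬝ᵥ u b - pb ⬝ᵥ u a) + s * ((1 : Θ → ℝ) ⬝ᵥ u b - (1 : Θ → ℝ) ⬝ᵥ u a) with hk'
  -- Each weight is the payoff gap at the other point, so the gaps cancel and `a`, `b` tie under
  -- `y`. Adding a little of `y` to `p` gives full support without breaking the strict inequalities.
  let y : Θ → ℝ := k' • (pa + s • 1) + k • (pb + s • 1)
  have hy : ∀ θ, 0 < y θ := by
    intro θ
    have h1 := hpa0.1 θ
    have h2 := hpb0.1 θ
    simp only [y, Pi.add_apply, Pi.smul_apply, Pi.one_apply, smul_eq_mul, mul_one]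
    positivity
  have hy0 : y ⬝ᵥ u a = y ⬝ᵥ u b := by
    simp only [y, add_dotProduct, smul_dotProduct, smul_eq_mul]
    rw [hk, hk']
    ring
  have hev : ∀ᶠ s in nhds (0 : ℝ), ∀ c, c ≠ a → c ≠ b →
      0 < (p ⬝ᵥ u a - p ⬝ᵥ u c) + s * (y ⬝ᵥ u a - y ⬝ᵥ u c) := by
    rw [Filter.eventually_all]
    intro c
    by_cases hca : c = a
    · simp [hca]
    by_cases hcb : c = b
    · simp [hcb]
    filter_upwards [eventually_pos_add_mul (sub_pos.2 (hpo.2 c hca hcb))] with s hs _ _ using hs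
  obtain ⟨t, ht, h, -⟩ := exists_pos_of_eventually hev
  let q : Θ → ℝ := p + t • y
  have hq : ∀ θ, 0 < q θ := fun θ =>
    add_pos_of_nonneg_of_pos (hp.1 θ) (mul_pos ht (hy θ))
  have hqs : 0 < ∑ θ, q θ := Finset.sum_pos (fun θ _ => hq θ) Finset.univ_nonempty
  refine ⟨_, inv_sum_smul_mem_stdSimplex (fun θ => (hq θ).le) hqs,
    fun θ => mul_pos (inv_pos.2 hqs) (hq θ), ?_⟩
  rw [optimalActions_smul _ _ (inv_pos.2 hqs), optimalActions_eq_pair_iff]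
  simp only [q, add_dotProduct, smul_dotProduct, smul_eq_mul]
  refine ⟨by rw [hpo.1, hy0], fun c hca hcb => ?_⟩
  have := h c hca hcb
  linarith

/-- If the answer at `a` is trivial, the answer at a neighbour `b` depends only on the payoff
difference. -/
theorem Incentivizable.row_eq_of_adj [Finite A] {m : ℕ} {u : A → Θ → ℝ}
    {X : A → Matrix (Fin m) Θ ℝ} (hred : NoRedundantActions u) (hX : Incentivizable u X)
    {a b : A} (hab : (adjacencyGraph u).Adj a b) (ha : X a = 0) (i : Fin m) :
    ∃ v w : ℝ, ∀ θ, X b i θ = v * (u b θ - u a θ) + w := by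
  obtain ⟨q, hq, hqpos, hqo⟩ := hred.exists_interior_tie hab
  obtain ⟨W, -, hW⟩ := hX
  -- Directions `z` orthogonal to both vectors keep `q + s • z`, for small `s` of either sign, among
  -- the beliefs with exactly this tie; the answer at `b` must not change along them.
  obtain ⟨c, hc⟩ := exists_eq_sum_smul_of_orthogonal ![u b - u a, 1] (X b i) (by
    intro z hz
    have hz0 : (u b - u a) ⬝ᵥ z = 0 := hz 0
    have hz1 : (1 : Θ → ℝ) ⬝ᵥ z = 0 := hz 1
    rw [optimalActions_eq_pair_iff] at hqo
    have hzab : z ⬝ᵥ u a = z ⬝ᵥ u b := by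
      rw [sub_dotProduct, dotProduct_comm, dotProduct_comm (u a)] at hz0
      linarith
    have hev1 : ∀ᶠ s in nhds (0 : ℝ), ∀ θ, 0 < q θ + s * z θ := by
      rw [Filter.eventually_all]
      exact fun θ => eventually_pos_add_mul (hqpos θ)
    have hev2 : ∀ᶠ s in nhds (0 : ℝ), ∀ c, c ≠ a → c ≠ b →
        0 < (q ⬝ᵥ u a - q ⬝ᵥ u c) + s * (z ⬝ᵥ u a - z ⬝ᵥ u c) := by
      rw [Filter.eventually_all]
      intro c
      by_cases hca : c = a
      · simp [hca]
      by_cases hcb : c = b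
      · simp [hcb]
      filter_upwards [eventually_pos_add_mul (sub_pos.2 (hqo.2 c hca hcb))] with s hs _ _ using hs
    have hev : ∀ᶠ s in nhds (0 : ℝ),
        q + s • z ∈ stdSimplex ℝ Θ ∧ optimalActions u (q + s • z) = {a, b} := by
      filter_upwards [hev1, hev2] with s h1 h2
      refine ⟨⟨fun θ => (h1 θ).le, ?_⟩, ?_⟩
      · have : ∑ θ, z θ = 0 := by simpa [dotProduct] using hz1
        simp [Finset.sum_add_distrib, ← Finset.mul_sum, this, hq.2]
      · rw [optimalActions_eq_pair_iff]
        simp only [add_dotProduct, smul_dotProduct, smul_eq_mul]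
        refine ⟨by rw [hqo.1, hzab], fun c hca hcb => ?_⟩
        have := h2 c hca hcb
        linarith
    have hmem : ∀ {x : Θ → ℝ}, x ∈ stdSimplex ℝ Θ → optimalActions u x = {a, b} →
        (∀ y : (Fin m → ℝ) × A, x ⬝ᵥ W y.1 y.2 ≤ x ⬝ᵥ W 0 a) ∧
        ∀ y : (Fin m → ℝ) × A, x ⬝ᵥ W y.1 y.2 ≤ x ⬝ᵥ W ((X b).mulVec x) b := by
      intro x hx hxo
      have key : ∀ c ∈ optimalActions u x, ∀ y : (Fin m → ℝ) × A,
          x ⬝ᵥ W y.1 y.2 ≤ x ⬝ᵥ W ((X c).mulVec x) c := by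
        intro c hcx
        have h : (((X c).mulVec x, c) : (Fin m → ℝ) × A) ∈
            argMax (fun y : (Fin m → ℝ) × A => ∑ θ, x θ * W y.1 y.2 θ) := by
          rw [hW x hx]
          exact ⟨hcx, rfl⟩
        exact h
      refine ⟨?_, key b (hxo ▸ Set.mem_insert_of_mem _ rfl)⟩
      have := key a (hxo ▸ Set.mem_insert _ _)
      rwa [ha, Matrix.zero_mulVec] at this
    obtain ⟨s, hs, ⟨hs1, hs2⟩, hs3, hs4⟩ := exists_pos_of_eventually hev
    set r := (X b).mulVec q with hr
    obtain ⟨m1, m2⟩ := hmem hq (optimalActions_eq_pair_iff.2 hqo)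
    obtain ⟨m3, -⟩ := hmem hs1 hs2
    obtain ⟨m4, -⟩ := hmem hs3 hs4
    have e1 := m1 (r, b)
    have e2 := m2 (0, a)
    have e3 := m3 (r, b)
    have e4 := m4 (r, b)
    simp only [add_dotProduct, smul_dotProduct, smul_eq_mul] at e1 e2 e3 e4
    -- The payoff of `(r, b)` minus that of `(0, a)` is affine in `s`, zero at `q` and nonpositive
    -- on both sides, hence zero. So `r` stays optimal at `q + s • z` and must be the truthful
    -- answer there.
    have heq : (q + s • z) ⬝ᵥ W r b = (q + s • z) ⬝ᵥ W 0 a := by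
      simp only [add_dotProduct, smul_dotProduct, smul_eq_mul]
      linarith
    have hrb : ((r, b) : (Fin m → ℝ) × A) ∈
        argMax (fun y : (Fin m → ℝ) × A => ∑ θ, (q + s • z) θ * W y.1 y.2 θ) :=
      fun y => (m3 y).trans_eq heq.symm
    rw [hW _ hs1] at hrb
    have h5 : r = (X b).mulVec (q + s • z) := hrb.2
    rw [Matrix.mulVec_add, ← hr, Matrix.mulVec_smul, left_eq_add] at h5
    have h6 := congrFun h5 i
    simp only [Pi.smul_apply, smul_eq_mul, Pi.zero_apply, mul_eq_zero, hs.ne', false_or] at h6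
    exact h6)
  refine ⟨c 0, c 1, fun θ => ?_⟩
  rw [hc θ, Fin.sum_univ_two]
  simp

end Model

/-! ### Robust incentivizability implies blockwise alignment -/

section Necessity

variable {Θ A : Type*} [Fintype Θ]

theorem centered_sub_eq [Nonempty Θ] {x x' y y' : Θ → ℝ} {v w : ℝ}
    (h : ∀ θ, y' θ - y θ = v * (x' θ - x θ) + w) (θ : Θ) :
    centered y' θ - centered y θ = v * (centered x' θ - centered x θ) := by
  have hc : (Fintype.card Θ : ℝ) ≠ 0 := Nat.cast_ne_zero.2 Fintype.card_ne_zero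
  have hs : ∑ θ, y' θ - ∑ θ, y θ =
      v * (∑ θ, x' θ - ∑ θ, x θ) + Fintype.card Θ * w := by
    rw [← Finset.sum_sub_distrib, ← Finset.sum_sub_distrib, Finset.mul_sum,
      Finset.sum_congr rfl fun θ _ => h θ, Finset.sum_add_distrib]
    simp
  unfold centered
  field_simp
  linear_combination (Fintype.card Θ : ℝ) * h θ - hs

/-- The shift `t = -(μ a)⁻¹ * X a` cancels the answer at `a`, so `row_eq_of_adj` applies to `b`;
multiplying by `(μ b)⁻¹` makes the edge relation a difference of one vertex function. -/
theorem RobustlyIncentivizable.exists_edge_coeffs [Finite A] {m : ℕ} {u : A → Θ → ℝ}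
    {X : A → Matrix (Fin m) Θ ℝ} (hred : NoRedundantActions u)
    {μ : A → Matrix (Fin m) (Fin m) ℝ} (hμ : ∀ a, IsUnit (μ a))
    (hX : ∀ t : Matrix (Fin m) Θ ℝ, Incentivizable u (fun a => X a + μ a * t))
    {a b : A} (hab : (adjacencyGraph u).Adj a b) :
    ∃ v w : Fin m → ℝ, ∀ i θ, ((μ b)⁻¹ * X b) i θ - ((μ a)⁻¹ * X a) i θ =
      v i * (u b θ - u a θ) + w i := by
  have hdet : ∀ a, IsUnit (μ a).det := fun a => (Matrix.isUnit_iff_isUnit_det _).1 (hμ a)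
  have h := (hX (-((μ a)⁻¹ * X a))).row_eq_of_adj hred hab (by
    rw [Matrix.mul_neg, Matrix.mul_nonsing_inv_cancel_left _ _ (hdet a), add_neg_cancel])
  choose v w h using h
  have hm : X b + μ b * -((μ a)⁻¹ * X a) =
      Matrix.vecMulVec v (u b - u a) + Matrix.vecMulVec w 1 := by
    ext i θ
    rw [h i θ]
    simp [Matrix.vecMulVec_apply]
  have hm' := congrArg ((μ b)⁻¹ * ·) hm
  simp only [Matrix.mul_add, Matrix.nonsing_inv_mul_cancel_left _ _ (hdet b),
    Matrix.mul_vecMulVec] at hm'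
  refine ⟨(μ b)⁻¹.mulVec v, (μ b)⁻¹.mulVec w, fun i θ => ?_⟩
  have := congrFun (congrFun hm' i) θ
  simpa [Matrix.vecMulVec_apply, sub_eq_add_neg] using this

theorem RobustlyIncentivizable.blockwiseJointlyAligned [Fintype A] {m : ℕ} {u : A → Θ → ℝ}
    {X : A → Matrix (Fin m) Θ ℝ} (hred : NoRedundantActions u) (hind : CycleIndependence u)
    (hX : RobustlyIncentivizable u X) : BlockwiseJointlyAligned u X := by
  classical
  rcases isEmpty_or_nonempty Θ with hΘ | hΘ
  · exact ⟨0, 0, 1, 0, fun _ => isUnit_one, fun _ _ _ => by ext i θ; exact hΘ.elim θ⟩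
  obtain ⟨μ, hμ, hX⟩ := hX
  obtain ⟨S, ⟨hS, -⟩, hrank⟩ := hind
  let Y : A → Matrix (Fin m) Θ ℝ := fun a => (μ a)⁻¹ * X a
  have hYX : ∀ a, μ a * Y a = X a := fun a =>
    Matrix.mul_nonsing_inv_cancel_left _ _ ((Matrix.isUnit_iff_isUnit_det _).1 (hμ a))
  have hedge : ∀ e : (adjacencyGraph u).edgeSet, ∃ v w : Fin m → ℝ, ∀ i θ,
      Y (edgeHead e) i θ - Y (edgeTail e) i θ =
        v i * (u (edgeHead e) θ - u (edgeTail e) θ) + w i := fun e =>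
    RobustlyIncentivizable.exists_edge_coeffs hred hμ hX (edge_adj e)
  choose v w hvw using hedge
  have hconst : ∀ i, ∀ C ∈ S, ∃ c, ∀ e, C.vec e ≠ 0 → v e i = c := by
    intro i C hC
    have hmem := hS.vec_mem hC
    refine C.constant_of_rank (fun a => centered (u a)) (hrank C hC).ge ?_ (fun e => v e i) ?_
    · ext θ
      simpa using sum_mul_sub_eq_zero hmem (fun a => centered (u a) θ)
    · ext θ
      have h0 := sum_mul_sub_eq_zero hmem (fun a => centered (Y a i) θ)
      simp only [Finset.sum_apply, Pi.smul_apply, Pi.sub_apply, smul_eq_mul, Pi.zero_apply]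
      rw [← h0]
      refine Finset.sum_congr rfl fun e _ => ?_
      rw [centered_sub_eq (hvw e i) θ]
      ring
  have hblock : ∀ (B : {B : (adjacencyGraph u).Subgraph // IsBlock B}) (i : Fin m), ∃ c : ℝ,
      ∀ e : (adjacencyGraph u).edgeSet, B.1.Adj (edgeTail e) (edgeHead e) → v e i = c := by
    intro B i
    obtain ⟨c, hc⟩ := hS.constant_on_block
      (fun s => if h : s ∈ (adjacencyGraph u).edgeSet then v ⟨s, h⟩ i else 0) (fun C hC => by
        obtain ⟨c, hc⟩ := hconst i C hC
        exact ⟨c, fun e he => by rw [dif_pos e.2]; exact hc e he⟩) B.2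
    refine ⟨c, fun e he => ?_⟩
    have := hc _ _ he
    rw [edge_eq, dif_pos e.2] at this
    exact this
  choose lam hlam using hblock
  -- On a basis cycle `v` is a constant `c`, so `w` is there the gradient of `Y - c u` at any fixed
  -- state and sums to zero.
  have hpot : ∀ i, ∃ k : A → ℝ, ∀ e, w e i = k (edgeHead e) - k (edgeTail e) := by
    intro i
    obtain ⟨θ⟩ := hΘ
    refine hS.exists_potential (fun e => w e i) fun C hC => ?_
    obtain ⟨c, hc⟩ := hconst i C hC
    have hmem := hS.vec_mem hC
    have h1 := sum_mul_sub_eq_zero hmem (fun a => Y a i θ)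
    have h2 := sum_mul_sub_eq_zero hmem (fun a => u a θ)
    calc ∑ e, C.vec e * w e i
        = ∑ e, (C.vec e * (Y (edgeHead e) i θ - Y (edgeTail e) i θ) -
            c * (C.vec e * (u (edgeHead e) θ - u (edgeTail e) θ))) := by
          refine Finset.sum_congr rfl fun e _ => ?_
          by_cases h0 : C.vec e = 0
          · simp [h0]
          · rw [hvw e i θ, hc e h0]
            ring
      _ = 0 := by rw [Finset.sum_sub_distrib, ← Finset.mul_sum, h1, h2, mul_zero, sub_zero]
  choose k hk using hpot
  have hstep : ∀ (B : {B : (adjacencyGraph u).Subgraph // IsBlock B}) (a b : A), B.1.Adj a b →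
      (fun i θ => Y a i θ - k i a - lam B i * u a θ) =
        fun i θ => Y b i θ - k i b - lam B i * u b θ := by
    intro B a b hab
    ext i θ
    let e : (adjacencyGraph u).edgeSet := ⟨s(a, b), hab.adj_sub⟩
    have h1 := hvw e i θ
    have h2 := hk i e
    have h3 := hlam B i e
    rcases Sym2.eq_iff.1 (edge_eq e) with ⟨h4, h5⟩ | ⟨h4, h5⟩
    · rw [h4, h5] at h1 h2 h3
      rw [h3 hab, h2] at h1
      linarith
    · rw [h4, h5] at h1 h2 h3
      rw [h3 hab.symm, h2] at h1
      linarith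
  have hd : ∀ B : {B : (adjacencyGraph u).Subgraph // IsBlock B}, ∃ d : Matrix (Fin m) Θ ℝ,
      ∀ a ∈ B.1.verts, ∀ i θ, Y a i θ - k i a - lam B i * u a θ = d i θ := by
    intro B
    obtain ⟨b, hb⟩ := B.2.prop.1.nonempty
    refine ⟨fun i θ => Y b i θ - k i b - lam B i * u b θ, fun a ha i θ => ?_⟩
    exact congrFun (congrFun (eq_of_preconnected B.2.prop.1.preconnected
      (fun a i θ => Y a i θ - k i a - lam B i * u a θ) (hstep B) ha hb) i) θ
  choose d hd using hd
  -- The potential is global, so `κ` depends on the action only, even for an action lying in several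
  -- blocks.
  refine ⟨lam, d, μ, fun a => (μ a).mulVec fun i => k i a, hμ, fun B a ha => ?_⟩
  have hY : Y a = Matrix.vecMulVec (lam B) (u a) + d B + Matrix.vecMulVec (fun i => k i a) 1 := by
    ext i θ
    simp [Matrix.vecMulVec_apply, ← hd B a ha i θ]
  rw [← hYX a, hY, Matrix.mul_add, Matrix.mul_vecMulVec]

end Necessity

/-! ### Blockwise alignment implies robust incentivizability -/

section Sufficiency

variable {Θ A : Type*} [Fintype Θ]

theorem argMax_eq_of_forall_le {α : Type*} {f : α → ℝ} {H : ℝ} {T : Set α} (hT : T.Nonempty)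
    (hle : ∀ x, f x ≤ H) (heq : ∀ x, f x = H ↔ x ∈ T) : argMax f = T := by
  obtain ⟨y, hy⟩ := hT
  ext x
  rw [← heq x]
  constructor
  · intro hx
    exact le_antisymm (hle x) (((heq y).2 hy).symm.trans_le (hx y))
  · intro hx z
    exact hx ▸ hle z

/-- Rescaling `[-K, K]` affinely onto `[0, 1]` keeps the maximizers, since beliefs sum to one. -/
theorem incentivizable_of_bounded {m : ℕ} {u : A → Θ → ℝ} {X : A → Matrix (Fin m) Θ ℝ}
    (W : (Fin m → ℝ) → A → Θ → ℝ) {K : ℝ} (hK : 0 < K) (hW : ∀ r a θ, |W r a θ| ≤ K)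
    (h : ∀ p ∈ stdSimplex ℝ Θ, argMax (fun x : (Fin m → ℝ) × A => p ⬝ᵥ W x.1 x.2) =
      {x | x.2 ∈ optimalActions u p ∧ x.1 = (X x.2).mulVec p}) : Incentivizable u X := by
  refine ⟨fun r a θ => (W r a θ + K) / (2 * K), fun r a θ => ?_, fun p hp => ?_⟩
  · have := abs_le.1 (hW r a θ)
    exact ⟨div_nonneg (by linarith) (by linarith), (div_le_one (by linarith)).2 (by linarith)⟩
  · rw [← h p hp]
    have hsum : ∀ r a, ∑ θ, p θ * ((W r a θ + K) / (2 * K)) = (p ⬝ᵥ W r a + K) / (2 * K) := by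
      intro r a
      have : ∑ θ, p θ * (W r a θ + K) = p ⬝ᵥ W r a + K := by
        simp only [mul_add, Finset.sum_add_distrib, ← Finset.sum_mul, hp.2, one_mul, dotProduct]
      rw [← this, Finset.sum_div]
      exact Finset.sum_congr rfl fun θ _ => by ring
    ext x
    simp only [argMax, Set.mem_ofPred_eq, hsum]
    refine forall_congr' fun y => ?_
    rw [div_le_div_iff_of_pos_right (by linarith), add_le_add_iff_right]

theorem dotProduct_self_nonneg {ι : Type*} [Fintype ι] (x : ι → ℝ) : 0 ≤ x ⬝ᵥ x :=
  Finset.sum_nonneg fun i _ => mul_self_nonneg (x i)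

theorem abs_dotProduct_le_of_mem_stdSimplex {p : Θ → ℝ} (hp : p ∈ stdSimplex ℝ Θ) (x : Θ → ℝ) :
    |x ⬝ᵥ p| ≤ ∑ θ, |x θ| := by
  refine (Finset.abs_sum_le_sum_abs _ _).trans (Finset.sum_le_sum fun θ _ => ?_)
  rw [abs_mul, abs_of_nonneg (hp.1 θ)]
  have h1 : p θ ≤ 1 := hp.2 ▸ Finset.single_le_sum (fun θ _ => hp.1 θ) (Finset.mem_univ θ)
  exact mul_le_of_le_one_right (abs_nonneg _) h1

/-- The value of action `a` under `p` when the answer `Y a` is rewarded quadratically. -/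
def quadraticValue {m : ℕ} (u : A → Θ → ℝ) (Y : A → Matrix (Fin m) Θ ℝ) (ε : ℝ) (a : A)
    (p : Θ → ℝ) : ℝ :=
  p ⬝ᵥ u a + ε * ((Y a).mulVec p ⬝ᵥ (Y a).mulVec p)

/-- As a difference of squares, the change of value factors as `(p ⬝ᵥ u b - p ⬝ᵥ u a) * (1 + ε * (l
⬝ᵥ (Y b p + Y a p)))`. By compactness of the simplex, and since there are finitely many edges, one
`ε` keeps every second factor positive. -/
theorem exists_quadraticValue_lt_of_adj [Finite A] {m : ℕ} {u : A → Θ → ℝ}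
    {Y : A → Matrix (Fin m) Θ ℝ}
    (hY : ∀ a b, (adjacencyGraph u).Adj a b →
      ∃ l, Y b - Y a = Matrix.vecMulVec l (u b - u a)) :
    ∃ ε > 0, ∀ a b, (adjacencyGraph u).Adj a b → ∀ p ∈ stdSimplex ℝ Θ, p ⬝ᵥ u a < p ⬝ᵥ u b →
      quadraticValue u Y ε a p < quadraticValue u Y ε b p := by
  have hev : ∀ᶠ ε in nhdsWithin (0 : ℝ) (Set.Ioi 0), ∀ a b, (adjacencyGraph u).Adj a b →
      ∀ p ∈ stdSimplex ℝ Θ, p ⬝ᵥ u a < p ⬝ᵥ u b →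
        quadraticValue u Y ε a p < quadraticValue u Y ε b p := by
    rw [Filter.eventually_all]
    intro a
    rw [Filter.eventually_all]
    intro b
    by_cases hab : (adjacencyGraph u).Adj a b
    swap
    · simp [hab]
    obtain ⟨l, hl⟩ := hY a b hab
    obtain ⟨K, hK⟩ := (isCompact_stdSimplex ℝ Θ).exists_bound_of_continuousOn
      (f := fun p => l ⬝ᵥ ((Y b).mulVec p + (Y a).mulVec p)) (by fun_prop)
    filter_upwards [self_mem_nhdsWithin, (eventually_pos_add_mul (b := -K)
      one_pos).filter_mono nhdsWithin_le_nhds] with ε hε hεK _ p hp hlt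
    have hε' : 0 < ε := hε
    have h1 := (abs_le.1 (hK p hp)).1
    have h2 : (Y b).mulVec p - (Y a).mulVec p = (p ⬝ᵥ u b - p ⬝ᵥ u a) • l := by
      rw [← Matrix.sub_mulVec, hl]
      ext i
      simp only [Matrix.mulVec, Matrix.vecMulVec, Matrix.of_apply, dotProduct, Pi.sub_apply,
        Pi.smul_apply, smul_eq_mul, ← Finset.sum_sub_distrib, Finset.sum_mul]
      exact Finset.sum_congr rfl fun θ _ => by ring
    have h3 : (Y b).mulVec p ⬝ᵥ (Y b).mulVec p - (Y a).mulVec p ⬝ᵥ (Y a).mulVec p =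
        (p ⬝ᵥ u b - p ⬝ᵥ u a) * (l ⬝ᵥ ((Y b).mulVec p + (Y a).mulVec p)) := by
      rw [← smul_eq_mul, ← smul_dotProduct, ← h2, sub_dotProduct, dotProduct_add, dotProduct_add,
        dotProduct_comm ((Y b).mulVec p) ((Y a).mulVec p)]
      ring
    have h4 : 0 < 1 + ε * (l ⬝ᵥ ((Y b).mulVec p + (Y a).mulVec p)) := by nlinarith
    have h5 := mul_pos (sub_pos.2 hlt) h4
    unfold quadraticValue
    linear_combination h5 - ε * h3
  obtain ⟨ε, h, hε⟩ := (hev.and self_mem_nhdsWithin).exists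
  exact ⟨ε, hε, h⟩

theorem NoRedundantActions.quadraticValue_lt [Finite A] {m : ℕ} {u : A → Θ → ℝ}
    (hred : NoRedundantActions u) {Y : A → Matrix (Fin m) Θ ℝ} {ε : ℝ}
    (hε : ∀ a b, (adjacencyGraph u).Adj a b → ∀ p ∈ stdSimplex ℝ Θ, p ⬝ᵥ u a < p ⬝ᵥ u b →
      quadraticValue u Y ε a p < quadraticValue u Y ε b p)
    {p : Θ → ℝ} (hp : p ∈ stdSimplex ℝ Θ) {b : A}
    (hb : ∃ p ∈ stdSimplex ℝ Θ, b ∈ optimalActions u p) (hbp : b ∉ optimalActions u p) :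
    ∃ c, (∃ p ∈ stdSimplex ℝ Θ, c ∈ optimalActions u p) ∧
      quadraticValue u Y ε b p < quadraticValue u Y ε c p := by
  obtain ⟨c, hbc, hlt⟩ := hred.exists_adj_lt hb hp hbp
  obtain ⟨-, q, hq, hqo⟩ := id hbc
  exact ⟨c, ⟨q, hq, hqo ▸ Set.mem_insert_of_mem _ rfl⟩, hε b c hbc p hp hlt⟩

/-- Local improvement does not compare two actions that are both optimal under `p`. Moving `p`
slightly towards a belief where `a` is uniquely optimal makes `a` the only possible maximizer;
continuity brings the inequality back to `p`. -/
theorem NoRedundantActions.quadraticValue_le [Finite A] {m : ℕ} {u : A → Θ → ℝ}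
    (hred : NoRedundantActions u) {Y : A → Matrix (Fin m) Θ ℝ} {ε : ℝ}
    (hε : ∀ a b, (adjacencyGraph u).Adj a b → ∀ p ∈ stdSimplex ℝ Θ, p ⬝ᵥ u a < p ⬝ᵥ u b →
      quadraticValue u Y ε a p < quadraticValue u Y ε b p)
    {p : Θ → ℝ} (hp : p ∈ stdSimplex ℝ Θ) {a c : A} (ha : a ∈ optimalActions u p)
    (hc : ∃ p ∈ stdSimplex ℝ Θ, c ∈ optimalActions u p) :
    quadraticValue u Y ε c p ≤ quadraticValue u Y ε a p := by
  obtain ⟨pa, hpa, hpao⟩ := hred a ⟨p, hp, ha⟩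
  rw [optimalActions_eq_singleton_iff] at hpao
  let q : ℝ → Θ → ℝ := fun δ => (1 - δ) • p + δ • pa
  have hq : ∀ δ ∈ Set.Ioc (0 : ℝ) 1,
      quadraticValue u Y ε c (q δ) ≤ quadraticValue u Y ε a (q δ) := by
    rintro δ ⟨h0, h1⟩
    have hqδ : q δ ∈ stdSimplex ℝ Θ :=
      convex_stdSimplex ℝ Θ hp hpa (sub_nonneg.2 h1) h0.le (by ring)
    have huniq : optimalActions u (q δ) = {a} := by
      rw [optimalActions_eq_singleton_iff]
      intro d hd
      simp only [q, add_dotProduct, smul_dotProduct, smul_eq_mul]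
      have e1 := mul_le_mul_of_nonneg_left (mem_optimalActions.1 ha d) (sub_nonneg.2 h1)
      have e2 := mul_lt_mul_of_pos_left (hpao d hd) h0
      linarith
    obtain ⟨d, hd, hmax⟩ := Set.exists_max_image
      {d | ∃ p ∈ stdSimplex ℝ Θ, d ∈ optimalActions u p}
      (fun d => quadraticValue u Y ε d (q δ)) (Set.toFinite _) ⟨c, hc⟩
    have hda : d = a := by
      by_contra hne
      obtain ⟨e, he, hlt⟩ := hred.quadraticValue_lt hε hqδ hd (by rw [huniq]; exact hne)
      exact absurd (hmax e he) (not_le.2 hlt)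
    exact hda ▸ hmax c hc
  have hcont : ∀ d, Continuous fun δ => quadraticValue u Y ε d (q δ) := by
    intro d
    unfold quadraticValue
    fun_prop
  have hlim : ∀ d, Filter.Tendsto (fun δ => quadraticValue u Y ε d (q δ))
      (nhdsWithin 0 (Set.Ioi 0)) (nhds (quadraticValue u Y ε d p)) := by
    intro d
    have := ((hcont d).tendsto 0).mono_left (nhdsWithin_le_nhds (s := Set.Ioi 0))
    simpa [q] using this
  refine le_of_tendsto_of_tendsto (hlim c) (hlim a) ?_
  filter_upwards [Ioc_mem_nhdsGT one_pos] with δ hδ using hq δ hδ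

theorem incentivizable_of_edges [Fintype A] {m : ℕ} {u : A → Θ → ℝ}
    {X : A → Matrix (Fin m) Θ ℝ} (hred : NoRedundantActions u)
    {Y : A → Matrix (Fin m) Θ ℝ} {Γ : A → Matrix (Fin m) (Fin m) ℝ} {κ : A → Fin m → ℝ}
    (hΓ : ∀ a, IsUnit (Γ a)) (hX : ∀ a, X a = Γ a * Y a + Matrix.vecMulVec (κ a) 1)
    (hY : ∀ a b, (adjacencyGraph u).Adj a b →
      ∃ l, Y b - Y a = Matrix.vecMulVec l (u b - u a)) : Incentivizable u X := by
  classical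
  obtain ⟨ε, hε, hval⟩ := exists_quadraticValue_lt_of_adj hY
  have hdet : ∀ a, IsUnit (Γ a).det := fun a => (Matrix.isUnit_iff_isUnit_det _).1 (hΓ a)
  let poss : A → Prop := fun a => ∃ p ∈ stdSimplex ℝ Θ, a ∈ optimalActions u p
  -- Decodes a report on `X a` into a report on `Y a`.
  let s : (Fin m → ℝ) → A → Fin m → ℝ := fun r a => (Γ a)⁻¹.mulVec (r - κ a)
  have hs : ∀ p ∈ stdSimplex ℝ Θ, ∀ r a, s r a = (Y a).mulVec p ↔ r = (X a).mulVec p := by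
    intro p hp r a
    have hXp : (X a).mulVec p = (Γ a).mulVec ((Y a).mulVec p) + κ a := by
      rw [hX, Matrix.add_mulVec, Matrix.mulVec_mulVec]
      congr 1
      ext i
      simp [Matrix.mulVec, Matrix.vecMulVec, dotProduct, ← Finset.mul_sum, hp.2]
    rw [hXp]
    constructor
    · intro h
      rw [← h]
      simp [s, Matrix.mulVec_mulVec, Matrix.mul_nonsing_inv _ (hdet a)]
    · rintro rfl
      simp [s, Matrix.mulVec_mulVec, Matrix.nonsing_inv_mul_cancel_left _ _ (hdet a)]
  obtain ⟨M, hM0, hM⟩ : ∃ M : ℝ, 0 ≤ M ∧ ∀ a i, ∑ θ, |Y a i θ| ≤ M :=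
    ⟨∑ a, ∑ i, ∑ θ, |Y a i θ|, by positivity, fun a i =>
      (Finset.single_le_sum (f := fun i => ∑ θ, |Y a i θ|) (fun _ _ => by positivity)
        (Finset.mem_univ i)).trans
      (Finset.single_le_sum (f := fun a => ∑ i, ∑ θ, |Y a i θ|) (fun _ _ => by positivity)
        (Finset.mem_univ a))⟩
  obtain ⟨N, hN0, hN⟩ : ∃ N : ℝ, 0 ≤ N ∧ ∀ a, ∑ θ, |u a θ| ≤ N :=
    ⟨∑ a, ∑ θ, |u a θ|, by positivity, fun a =>
      Finset.single_le_sum (f := fun a => ∑ θ, |u a θ|) (fun _ _ => by positivity)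
        (Finset.mem_univ a)⟩
  have hYM : ∀ a i θ, |Y a i θ| ≤ M := fun a i θ =>
    (Finset.single_le_sum (f := fun θ => |Y a i θ|) (fun _ _ => abs_nonneg _)
      (Finset.mem_univ θ)).trans (hM a i)
  have huN : ∀ a θ, |u a θ| ≤ N := fun a θ =>
    (Finset.single_le_sum (f := fun θ => |u a θ|) (fun _ _ => abs_nonneg _)
      (Finset.mem_univ θ)).trans (hN a)
  -- Truncation at `M` keeps `W` bounded and never excludes a truthful answer. The penalty lies
  -- below every expected task payoff, so it also deters actions that are never optimal.
  let W : (Fin m → ℝ) → A → Θ → ℝ := fun r a θ =>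
    if poss a ∧ ∀ i, |s r a i| ≤ M then
      u a θ + ε * ∑ i, (2 * s r a i * Y a i θ - s r a i * s r a i)
    else -(N + 1)
  -- Completing the square: the loss from misreporting is the squared distance to the truth.
  have hWin : ∀ p ∈ stdSimplex ℝ Θ, ∀ r a, (poss a ∧ ∀ i, |s r a i| ≤ M) →
      p ⬝ᵥ W r a = quadraticValue u Y ε a p -
        ε * ((s r a - (Y a).mulVec p) ⬝ᵥ (s r a - (Y a).mulVec p)) := by
    intro p hp r a h
    have h1 : W r a = u a + ε • ((2 : ℝ) • Matrix.vecMul (s r a) (Y a) - (s r a ⬝ᵥ s r a) • 1) := by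
      ext θ
      simp only [W, if_pos h, Pi.add_apply, Pi.smul_apply, Pi.sub_apply, smul_eq_mul,
        Pi.one_apply, Matrix.vecMul, dotProduct, Finset.sum_sub_distrib, mul_assoc, mul_one,
        ← Finset.mul_sum]
    have h2 : p ⬝ᵥ (1 : Θ → ℝ) = 1 := by simpa [dotProduct] using hp.2
    have h3 : p ⬝ᵥ Matrix.vecMul (s r a) (Y a) = s r a ⬝ᵥ (Y a).mulVec p := by
      rw [dotProduct_comm, Matrix.dotProduct_mulVec]
    rw [h1, quadraticValue]
    simp only [dotProduct_add, dotProduct_sub, sub_dotProduct, dotProduct_smul, smul_eq_mul,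
      h2, h3, dotProduct_comm ((Y a).mulVec p) (s r a)]
    ring
  have hWout : ∀ p ∈ stdSimplex ℝ Θ, ∀ r a, ¬ (poss a ∧ ∀ i, |s r a i| ≤ M) →
      p ⬝ᵥ W r a = -(N + 1) := by
    intro p hp r a h
    simp only [W, if_neg h, dotProduct, ← Finset.sum_mul, hp.2, one_mul]
  refine incentivizable_of_bounded W (K := N + 1 + ε * (m * (3 * (M * M)))) (by positivity)
    (fun r a θ => ?_) (fun p hp => ?_)
  · by_cases h : poss a ∧ ∀ i, |s r a i| ≤ M
    · have hsum : |∑ i, (2 * s r a i * Y a i θ - s r a i * s r a i)| ≤ m * (3 * (M * M)) := by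
        refine (Finset.abs_sum_le_sum_abs _ _).trans ?_
        have : ∀ i ∈ Finset.univ, |2 * s r a i * Y a i θ - s r a i * s r a i| ≤ 3 * (M * M) := by
          intro i _
          have e1 := h.2 i
          have e2 := mul_le_mul e1 (hYM a i θ) (abs_nonneg _) hM0
          have e3 := mul_le_mul e1 e1 (abs_nonneg _) hM0
          calc _ ≤ |2 * s r a i * Y a i θ| + |s r a i * s r a i| := abs_sub _ _
            _ = 2 * (|s r a i| * |Y a i θ|) + |s r a i| * |s r a i| := by
              rw [abs_mul, abs_mul, abs_mul, abs_two, mul_assoc]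
            _ ≤ 3 * (M * M) := by linarith
        simpa using Finset.sum_le_sum this
      simp only [W, if_pos h]
      refine (abs_add_le _ _).trans ?_
      rw [abs_mul, abs_of_pos hε]
      have := mul_le_mul_of_nonneg_left hsum hε.le
      have := huN a θ
      linarith
    · simp only [W, if_neg h]
      rw [abs_neg, abs_of_pos (by linarith)]
      have : 0 ≤ ε * (m * (3 * (M * M))) := by positivity
      linarith
  · rcases isEmpty_or_nonempty A with hA | hA
    · ext x
      exact hA.elim x.2
    obtain ⟨a₀, h₀⟩ := Finite.exists_max fun a => p ⬝ᵥ u a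
    have ha₀ : a₀ ∈ optimalActions u p := mem_optimalActions.2 h₀
    have hlow : -(N + 1) < quadraticValue u Y ε a₀ p := by
      have h1 := (abs_le.1 (abs_dotProduct_le_of_mem_stdSimplex hp (u a₀))).1
      have h2 := hN a₀
      have h3 : 0 ≤ ε * ((Y a₀).mulVec p ⬝ᵥ (Y a₀).mulVec p) :=
        mul_nonneg hε.le (dotProduct_self_nonneg _)
      rw [quadraticValue, dotProduct_comm]
      linarith
    have hle : ∀ a, poss a → quadraticValue u Y ε a p ≤ quadraticValue u Y ε a₀ p := fun a ha =>
      hred.quadraticValue_le hval hp ha₀ ha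
    refine argMax_eq_of_forall_le (H := quadraticValue u Y ε a₀ p)
      ⟨((X a₀).mulVec p, a₀), ha₀, rfl⟩ ?_ ?_
    · rintro ⟨r, a⟩
      by_cases h : poss a ∧ ∀ i, |s r a i| ≤ M
      · simp only [hWin p hp r a h]
        have := mul_nonneg hε.le (dotProduct_self_nonneg (s r a - (Y a).mulVec p))
        have := hle a h.1
        linarith
      · simp only [hWout p hp r a h]
        exact hlow.le
    · rintro ⟨r, a⟩
      simp only [Set.mem_ofPred_eq, ← hs p hp]
      constructor
      · intro heq
        by_cases h : poss a ∧ ∀ i, |s r a i| ≤ M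
        · rw [hWin p hp r a h] at heq
          have h1 := mul_nonneg hε.le (dotProduct_self_nonneg (s r a - (Y a).mulVec p))
          have h2 := hle a h.1
          have h3 : ε * ((s r a - (Y a).mulVec p) ⬝ᵥ (s r a - (Y a).mulVec p)) = 0 := by linarith
          refine ⟨?_, sub_eq_zero.1
            (dotProduct_self_eq_zero.1 ((mul_eq_zero.1 h3).resolve_left hε.ne'))⟩
          by_contra hna
          obtain ⟨c, hc, hlt⟩ := hred.quadraticValue_lt hval hp h.1 hna
          have := hle c hc
          linarith
        · rw [hWout p hp r a h] at heq
          exact absurd heq hlow.ne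
      · rintro ⟨ha, hsa⟩
        have hposs : poss a := ⟨p, hp, ha⟩
        have h : poss a ∧ ∀ i, |s r a i| ≤ M := ⟨hposs, fun i => by
          rw [hsa]
          exact (abs_dotProduct_le_of_mem_stdSimplex hp (Y a i)).trans (hM a i)⟩
        rw [hWin p hp r a h, hsa, sub_self, dotProduct_zero, mul_zero, sub_zero]
        exact le_antisymm (hle a hposs)
          (hred.quadraticValue_le hval hp ha ⟨p, hp, ha₀⟩)

theorem BlockwiseJointlyAligned.robustlyIncentivizable [Fintype A] {m : ℕ} {u : A → Θ → ℝ}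
    {X : A → Matrix (Fin m) Θ ℝ} (hred : NoRedundantActions u)
    (hX : BlockwiseJointlyAligned u X) : RobustlyIncentivizable u X := by
  obtain ⟨lam, d, Γ, κ, hΓ, hX⟩ := hX
  have hdet : ∀ a, IsUnit (Γ a).det := fun a => (Matrix.isUnit_iff_isUnit_det _).1 (hΓ a)
  refine ⟨Γ, hΓ, fun t => ?_⟩
  refine incentivizable_of_edges hred hΓ
    (Y := fun a => (Γ a)⁻¹ * (X a - Matrix.vecMulVec (κ a) 1) + t) (κ := κ) (fun a => ?_)
    (fun a b hab => ?_)
  · rw [Matrix.mul_add, Matrix.mul_nonsing_inv_cancel_left _ _ (hdet a)]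
    abel
  · obtain ⟨B, hB, ha, hb⟩ := exists_isBlock_of_adj hab
    refine ⟨lam ⟨B, hB⟩, ?_⟩
    -- Both ends share the block's `d` and the common shift `t`, which cancel and leave `lam` times
    -- the payoff difference.
    simp only [hX ⟨B, hB⟩ a ha, hX ⟨B, hB⟩ b hb, add_sub_cancel_right,
      Matrix.nonsing_inv_mul_cancel_left _ _ (hdet _), Matrix.vecMulVec_sub]
    abel

end Sufficiency

end BeliefElicitation

theorem mainTheorem3 {Θ A : Type*} [Fintype Θ] [Fintype A] {m : ℕ}
    (u : A → Θ → ℝ) (X : A → Matrix (Fin m) Θ ℝ)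
    (hred : BeliefElicitation.NoRedundantActions u)
    (hind : BeliefElicitation.CycleIndependence u) :
    BeliefElicitation.RobustlyIncentivizable u X ↔
      BeliefElicitation.BlockwiseJointlyAligned u X :=
  ⟨fun h => h.blockwiseJointlyAligned hred hind, fun h => h.robustlyIncentivizable hred⟩
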